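/- Let $(W,S)$ be the Coxeter system of type $A_\infty^{\langle 1\rangle}$, that is, $S=\{s_1,s_2,s_3,\dots\}$ with $m(s_i,s_{i+1})=3$ for all $i\ge 1$ and $m(s_i,s_j)=2$ whenever $|i-j|\ge 2$ (this system is irreducible: its Coxeter graph is a one-way infinite path, hence connected). Let $\Phi=\Phi^+\cup\Phi^-$ be its root system in the geometric representation, with simple roots $\alpha_i=\alpha_{s_i}$, and let $s_\gamma\in W$ denote the reflection along $\gamma\in\Phi$. For a reflection subgroup $H\le W$ (a subgroup generated by reflections) put $\Phi(H)=\{\gamma\in\Phi : s_\gamma\in H\}$, let $\Pi(H)$ be the set of those $\gamma\in\Phi(H)\cap\Phi^+$ such that $\gamma=\sum_{i=1}^k c_i\gamma_i$ with $c_i>0$ and $\gamma_i\in\Phi(H)\cap\Phi^+$ forces $\gamma_i=\gamma$ for all $i$, and put $S(H)=\{s_\gamma:\gamma\in\Pi(H)\}$. A parabolic subgroup of $W$ is a conjugate $wW_Iw^{-1}$ of a subgroup $W_I=\langle I\rangle$ with $I\subseteq S$; the parabolic closure of a subset of $W$ is the intersection of all parabolic subgroups that contain it. For $i\ge 1$ let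 $\beta_i=\alpha_{2i-1}+\alpha_{2i}$, let $X=\{s_{\beta_i}: i\ge 1\}$ and $G=\langle X\rangle$. For $n\ge 0$ let $Y_n=\{s_{\beta_1},\dots,s_{\beta_n}\}\cup\{s_k : k\ge 2n+1\}$ and $G_n=\langle Y_n\rangle$. Then: 1. Each $\beta_i$ is a positive root, and $G$ is a reflection subgroup of $W$ with $\Pi(G)=\{\beta_i : i\ge 1\}$ and $S(G)=X$. Moreover $(G,X)$, with generators in the order $s_{\beta_1},s_{\beta_2},\dots$, is a Coxeter system of type $A_\infty^{\langle 1\rangle}$; in particular it is irreducible. 2. $G$ is equal to its own parabolic closure, but $G$ is not a parabolic subgroup of $W$. 3. Each $G_n$ is a parabolic subgroup of $W$, with $\Pi(G_n)=\{\beta_1,\dots,\beta_n\}\cup\{\alpha_k : k\ge 2n+1\}$ and $S(G_n)=Y_n$, and $(G_n,Y_n)$, with generators in the order $s_{\beta_1},\dots,s_{\beta_n},s_{2n+1},s_{2n+2},\dots$, is a Coxeter system of type $A_\infty^{\langle 1\rangle}$. Moreover $W=G_0\supsetneq G_1\supsetneq G_2\supsetneq\cdots$ and $\bigcap_{n\ge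 0}G_n=G$. -/

import Mathlib

/-! ## Coxeter graph and irreducibility -/

/-- The Coxeter graph: distinct `s`, `t` are joined iff `m(s,t) ≠ 2`, i.e. `3 ≤ m(s,t) ≤ ∞`
(recall that Mathlib encodes `m(s,t) = ∞` by the entry `0`). -/
def CoxeterMatrix.coxeterGraph {B : Type*} (M : CoxeterMatrix B) : SimpleGraph B where
  Adj s t := s ≠ t ∧ M s t ≠ 2
  symm := ⟨fun s t h => ⟨h.1.symm, by rw [M.symmetric]; exact h.2⟩⟩
  loopless := ⟨fun _ h => h.1 rfl⟩

/-- A Coxeter matrix is irreducible if its Coxeter graph is (nonempty and) connected. -/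
def CoxeterMatrix.IsIrreducible {B : Type*} (M : CoxeterMatrix B) : Prop :=
  M.coxeterGraph.Connected

/-- The Coxeter matrix of type `A_∞^⟨1⟩`: a one-way infinite path
`o --- o --- o --- ⋯`. The vertex `k : ℕ` stands for the `(k+1)`-st generator `s_{k+1}`. -/
def coxeterMatrixAInfOne : CoxeterMatrix ℕ where
  M := Matrix.of fun i j : ℕ => if i = j then 1 else if j + 1 = i ∨ i + 1 = j then 3 else 2
  isSymm := by
    ext i j
    simp only [Matrix.transpose_apply, Matrix.of_apply]
    split_ifs <;> omega
  diagonal i := by simp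
  off_diagonal i j h := by
    simp only [Matrix.of_apply, if_neg h]
    split_ifs <;> omega

/-! ## The geometric representation -/

/-- The geometric representation space `V`, with canonical basis the simple roots. -/
abbrev CoxeterMatrix.GeomSpace {B : Type*} (_M : CoxeterMatrix B) : Type _ := B →₀ ℝ

/-- The simple root `α_s`. -/
noncomputable def CoxeterMatrix.simpleRoot {B : Type*} (M : CoxeterMatrix B) (s : B) :
    M.GeomSpace := Finsupp.single s 1

/-- The bilinear form on `V` with `⟨α_s, α_t⟩ = - cos (π / m(s,t))`.
For `m(s,t) = ∞`, encoded by `0`, the value is `- cos 0 = -1`, as it should be. -/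
noncomputable def CoxeterMatrix.geomForm {B : Type*} (M : CoxeterMatrix B) :
    LinearMap.BilinForm ℝ M.GeomSpace :=
  Finsupp.linearCombination ℝ fun s =>
    Finsupp.linearCombination ℝ fun t => -Real.cos (Real.pi / (M s t : ℝ))

theorem CoxeterMatrix.geomForm_simpleRoot {B : Type*} (M : CoxeterMatrix B) (s t : B) :
    M.geomForm (M.simpleRoot s) (M.simpleRoot t) = -Real.cos (Real.pi / (M s t : ℝ)) := by
  simp [CoxeterMatrix.geomForm, CoxeterMatrix.simpleRoot]

theorem CoxeterMatrix.two_geomForm_self {B : Type*} (M : CoxeterMatrix B) (s : B) :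
    ((2 : ℝ) • M.geomForm (M.simpleRoot s)) (M.simpleRoot s) = 2 := by
  simp [CoxeterMatrix.geomForm_simpleRoot]

/-- The reflection `v ↦ v - 2 ⟨α_s, v⟩ α_s` of `V`. -/
noncomputable def CoxeterMatrix.simpleReflection {B : Type*} (M : CoxeterMatrix B) (s : B) :
    M.GeomSpace ≃ₗ[ℝ] M.GeomSpace :=
  Module.reflection (M.two_geomForm_self s)

theorem CoxeterMatrix.simpleReflection_apply {B : Type*} (M : CoxeterMatrix B) (s : B)
    (v : M.GeomSpace) :
    M.simpleReflection s v = v - (2 * M.geomForm (M.simpleRoot s) v) • M.simpleRoot s := by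
  simp [CoxeterMatrix.simpleReflection, Module.reflection_apply]

/-- The reflections `σ_s` satisfy the Coxeter relations. -/
theorem CoxeterMatrix.isLiftable_simpleReflection {B : Type*} (M : CoxeterMatrix B) :
    M.IsLiftable M.simpleReflection := by
  intro s t
  apply LinearEquiv.toLinearMap_injective
  set m := M s t with hm
  set θ : ℝ := 2 * (Real.pi / m) with hθ
  have ht : 2 * Real.cos θ = ((2 : ℝ) • M.geomForm (M.simpleRoot s)) (M.simpleRoot t) *
      ((2 : ℝ) • M.geomForm (M.simpleRoot t)) (M.simpleRoot s) - 2 := by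
    simp only [LinearMap.smul_apply, CoxeterMatrix.geomForm_simpleRoot, M.symmetric t s, smul_eq_mul,
      ← hm, hθ, Real.cos_two_mul]
    ring
  rw [CoxeterMatrix.simpleReflection, CoxeterMatrix.simpleReflection,
    Module.reflection_mul_reflection_pow _ _ m (2 * Real.cos θ) ht]
  have hS := fun n : ℤ => Polynomial.Chebyshev.S_two_mul_real_cos θ n
  obtain h0 | h1 | h2 | h3 : m = 0 ∨ m = 1 ∨ m = 2 ∨ 3 ≤ m := by omega
  · rw [h0]; simp
  · have hst : s = t := by
      by_contra h; exact M.off_diagonal s t h h1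
    subst hst
    rw [h1]
    apply LinearMap.ext
    intro v
    simp [CoxeterMatrix.geomForm_simpleRoot]
    module
  · have hc : Real.cos θ = -1 := by rw [hθ, h2]; norm_num [mul_div_cancel₀]
    rw [h2, hc]
    have e1 : M.geomForm (M.simpleRoot s) (M.simpleRoot t) = 0 := by
      rw [CoxeterMatrix.geomForm_simpleRoot, ← hm, h2]; simp
    have e2 : M.geomForm (M.simpleRoot t) (M.simpleRoot s) = 0 := by
      rw [CoxeterMatrix.geomForm_simpleRoot, M.symmetric, ← hm, h2]; simp
    apply LinearMap.ext
    intro v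
    simp [e1, e2]
    module
  · have hmpos : (0 : ℝ) < m := by positivity
    have hm3 : (3 : ℝ) ≤ m := by exact_mod_cast h3
    have hmθ : (m : ℝ) * θ = 2 * Real.pi := by rw [hθ]; field_simp
    have hsin : Real.sin θ ≠ 0 := by
      apply ne_of_gt
      apply Real.sin_pos_of_pos_of_lt_pi
      · rw [hθ]; have := Real.pi_pos; positivity
      · nlinarith [Real.pi_pos]
    obtain ⟨k, hk | hk⟩ := Nat.even_or_odd' m
    · have hz : (Polynomial.Chebyshev.S ℝ ((k : ℤ) - 1)).eval (2 * Real.cos θ) = 0 := by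
        have h := hS ((k : ℤ) - 1)
        have : ((((k : ℤ) - 1 : ℤ) : ℝ) + 1) * θ = Real.pi := by
          have hk' : (m : ℝ) = 2 * k := by exact_mod_cast hk
          rw [hk'] at hmθ
          push_cast
          linarith
        rw [this, Real.sin_pi] at h
        exact (mul_eq_zero.mp h).resolve_right hsin
      have i1 : ((m : ℤ) - 2) / 2 = (k : ℤ) - 1 := by omega
      have i2 : ((m : ℤ) - 1) / 2 = (k : ℤ) - 1 := by omega
      rw [i1, i2, hz]
      simp
    · have hz : (Polynomial.Chebyshev.S ℝ (k : ℤ)).eval (2 * Real.cos θ) +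
          (Polynomial.Chebyshev.S ℝ ((k : ℤ) - 1)).eval (2 * Real.cos θ) = 0 := by
        have h := hS (k : ℤ)
        have h' := hS ((k : ℤ) - 1)
        have : ((k : ℤ) + 1 : ℝ) * θ = 2 * Real.pi - ((((k : ℤ) - 1 : ℤ) : ℝ) + 1) * θ := by
          have hk' : (m : ℝ) = 2 * k + 1 := by exact_mod_cast hk
          rw [hk'] at hmθ
          push_cast
          linarith
        rw [this, Real.sin_two_pi_sub] at h
        have : ((Polynomial.Chebyshev.S ℝ (k : ℤ)).eval (2 * Real.cos θ) +
          (Polynomial.Chebyshev.S ℝ ((k : ℤ) - 1)).eval (2 * Real.cos θ)) * Real.sin θ = 0 := by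
          rw [add_mul, h, h']; ring
        exact (mul_eq_zero.mp this).resolve_right hsin
      have i1 : ((m : ℤ) - 2) / 2 = (k : ℤ) - 1 := by omega
      have i2 : ((m : ℤ) - 1) / 2 = (k : ℤ) := by omega
      have i3 : ((m : ℤ) - 3) / 2 = (k : ℤ) - 1 := by omega
      have i4 : (m : ℤ) / 2 = (k : ℤ) := by omega
      rw [i1, i2, i3, i4, hz]
      simp

namespace CoxeterSystem

/-! ## Roots and reflections -/

/-- The geometric representation `W → GL(V)`, with `s ↦ σ_s`. -/
noncomputable def geomRep {B W : Type*} [Group W] {M : CoxeterMatrix B} (cs : CoxeterSystem M W) :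
    W →* (M.GeomSpace ≃ₗ[ℝ] M.GeomSpace) :=
  cs.lift ⟨M.simpleReflection, M.isLiftable_simpleReflection⟩

theorem geomRep_simple {B W : Type*} [Group W] {M : CoxeterMatrix B} (cs : CoxeterSystem M W)
    (s : B) : cs.geomRep (cs.simple s) = M.simpleReflection s :=
  cs.lift_apply_simple M.isLiftable_simpleReflection s

/-- The root system `Φ = W · Π`. -/
def roots {B W : Type*} [Group W] {M : CoxeterMatrix B} (cs : CoxeterSystem M W) :
    Set M.GeomSpace :=
  {γ | ∃ (w : W) (s : B), cs.geomRep w (M.simpleRoot s) = γ}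

/-- The positive roots `Φ⁺`: roots with nonnegative coefficients. -/
def posRoots {B W : Type*} [Group W] {M : CoxeterMatrix B} (cs : CoxeterSystem M W) :
    Set M.GeomSpace :=
  {γ | γ ∈ cs.roots ∧ ∀ s : B, 0 ≤ γ s}

/-- The reflection `s_γ = w s w⁻¹ ∈ W` along the root `γ = w · α_s`. (It does not depend on the
choice of `w` and `s`; the value at a vector that is not a root is irrelevant.) -/
noncomputable def rootReflection {B W : Type*} [Group W] {M : CoxeterMatrix B}
    (cs : CoxeterSystem M W) (γ : M.GeomSpace) : W :=
  open Classical in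
  if h : ∃ t : W, ∃ (w : W) (s : B), cs.geomRep w (M.simpleRoot s) = γ ∧ t = w * cs.simple s * w⁻¹
  then h.choose else 1

theorem rootReflection_spec {B W : Type*} [Group W] {M : CoxeterMatrix B}
    (cs : CoxeterSystem M W) {γ : M.GeomSpace} (hγ : γ ∈ cs.roots) :
    ∃ (w : W) (s : B), cs.geomRep w (M.simpleRoot s) = γ ∧
      cs.rootReflection γ = w * cs.simple s * w⁻¹ := by
  have h : ∃ t : W, ∃ (w : W) (s : B),
      cs.geomRep w (M.simpleRoot s) = γ ∧ t = w * cs.simple s * w⁻¹ := by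
    obtain ⟨w, s, h⟩ := hγ
    exact ⟨_, w, s, h, rfl⟩
  rw [rootReflection, dif_pos h]
  exact h.choose_spec

/-! ## Reflection subgroups and their canonical generators -/

/-- A reflection subgroup is a subgroup generated by reflections. -/
def IsReflectionSubgroup {B W : Type*} [Group W] {M : CoxeterMatrix B} (cs : CoxeterSystem M W)
    (G : Subgroup W) : Prop :=
  ∃ T : Set W, (∀ t ∈ T, cs.IsReflection t) ∧ G = Subgroup.closure T

/-- `Φ(G)`: the roots `γ` with `s_γ ∈ G`. -/
def rootsOf {B W : Type*} [Group W] {M : CoxeterMatrix B} (cs : CoxeterSystem M W)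
    (G : Subgroup W) : Set M.GeomSpace :=
  {γ | γ ∈ cs.roots ∧ cs.rootReflection γ ∈ G}

/-- `Π(G)`: the simple roots of `Φ(G)`, i.e. those `γ ∈ Φ(G) ∩ Φ⁺` such that
`γ = ∑ c_i β_i` with `c_i > 0` and `β_i ∈ Φ(G) ∩ Φ⁺` only if `β_i = γ` for all `i`. -/
def simpleRootsOf {B W : Type*} [Group W] {M : CoxeterMatrix B} (cs : CoxeterSystem M W)
    (G : Subgroup W) : Set M.GeomSpace :=
  {γ | γ ∈ cs.rootsOf G ∩ cs.posRoots ∧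
    ∀ (k : ℕ) (c : Fin k → ℝ) (b : Fin k → M.GeomSpace),
      (∀ i, 0 < c i) → (∀ i, b i ∈ cs.rootsOf G ∩ cs.posRoots) →
      γ = ∑ i, c i • b i → ∀ i, b i = γ}

/-- `S(G) = {s_γ | γ ∈ Π(G)}`: the canonical generating set of a reflection subgroup `G`. -/
def canonicalGenerators {B W : Type*} [Group W] {M : CoxeterMatrix B} (cs : CoxeterSystem M W)
    (G : Subgroup W) : Set W :=
  cs.rootReflection '' cs.simpleRootsOf G

/-! ## Parabolic subgroups and parabolic closures -/

/-- The standard parabolic subgroup `W_I`. -/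
def standardParabolic {B W : Type*} [Group W] {M : CoxeterMatrix B} (cs : CoxeterSystem M W)
    (I : Set B) : Subgroup W :=
  Subgroup.closure (cs.simple '' I)

/-- A parabolic subgroup is a conjugate `w W_I w⁻¹` of a standard parabolic subgroup. -/
def IsParabolic {B W : Type*} [Group W] {M : CoxeterMatrix B} (cs : CoxeterSystem M W)
    (P : Subgroup W) : Prop :=
  ∃ (w : W) (I : Set B), P = (cs.standardParabolic I).map (MulAut.conj w).toMonoidHom

/-- The parabolic closure of `X ⊆ W`: the intersection of all parabolic subgroups containing `X`. -/
def parabolicClosure {B W : Type*} [Group W] {M : CoxeterMatrix B} (cs : CoxeterSystem M W)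
    (X : Set W) : Subgroup W :=
  sInf {P : Subgroup W | cs.IsParabolic P ∧ X ⊆ (P : Set W)}

end CoxeterSystem

/-! ## The objects of the example

In `A_∞^⟨1⟩` the generator `s_k` (`k ≥ 1`) is the vertex `k - 1 : ℕ`. -/

/-- `exampleRoot i` is `β_{i+1} = α_{2i+1} + α_{2i+2}`, where `α_k` is the simple root at the vertex
`k - 1`. -/
noncomputable def exampleRoot (i : ℕ) : coxeterMatrixAInfOne.GeomSpace :=
  coxeterMatrixAInfOne.simpleRoot (2 * i) + coxeterMatrixAInfOne.simpleRoot (2 * i + 1)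

/-- The reflection subgroup `G` generated by `X = {s_{β_i} | i ≥ 1}`. -/
noncomputable def exampleSubgroup {W : Type*} [Group W]
    (cs : CoxeterSystem coxeterMatrixAInfOne W) : Subgroup W :=
  Subgroup.closure (Set.range fun i : ℕ => cs.rootReflection (exampleRoot i))

/-- The `n`-th term `G_n` of the chain, generated by `s_{β_1}, …, s_{β_n}` and by all `s_k` with
`k ≥ 2n + 1` (i.e. by the vertices `k ≥ 2n`). -/
noncomputable def exampleChain {W : Type*} [Group W]
    (cs : CoxeterSystem coxeterMatrixAInfOne W) (n : ℕ) : Subgroup W :=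
  Subgroup.closure ((fun i : ℕ => cs.rootReflection (exampleRoot i)) '' {i | i < n} ∪
    cs.simple '' {k | 2 * n ≤ k})

open Equiv

/-! ### Coxeter relations of type `A_∞^⟨1⟩` and irreducibility. -/

namespace CoxeterMatrix

/-! `W` is the group of finitely supported permutations of `ℕ`, via `s_k ↦ (k k+1)`; faithfulness
(`perm_injective`) comes from a normal form. Roots are the differences `vec i - vec j` with `i ≠ j`,
positive exactly when `i < j`, and the corresponding reflection is the transposition `(i j)`. So
root and reflection questions become questions about subsets of `ℕ`.

The reflections exchanging consecutive terms of a strictly increasing sequence generate all elements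
supported in its range (`seqSubgroup_eq_supportedIn`). They are the canonical generators of that
subgroup and satisfy the same Coxeter presentation, by relabelling. `G` belongs to the even numbers,
and `G_n` to the numbers that are even or at least `2n`.

The set for `G_n` misses just `n` points, so an element of `W` carries `{n, n+1, …}` onto it and
`G_n` is parabolic. These sets intersect in the even numbers, so `G` is its own parabolic closure.
The even numbers have infinite complement as well as being infinite, and conjugation by a finitely
supported permutation cannot produce such a set from a standard parabolic subgroup. -/

theorem aInfOne_apply_eq_three (i : ℕ) : coxeterMatrixAInfOne i (i + 1) = 3 := by
  change (if i = i + 1 then 1 else if i + 1 + 1 = i ∨ i + 1 = i + 1 then 3 else 2) = 3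
  simp

theorem aInfOne_apply_eq_three' (i : ℕ) : coxeterMatrixAInfOne (i + 1) i = 3 := by
  rw [CoxeterMatrix.symmetric, aInfOne_apply_eq_three]

theorem aInfOne_apply_eq_two {i j : ℕ} (h : i + 1 < j) : coxeterMatrixAInfOne i j = 2 := by
  change (if i = j then 1 else if j + 1 = i ∨ i + 1 = j then 3 else 2) = 2
  rw [if_neg (by omega), if_neg (by omega)]

/-- To satisfy the relations of type `A_∞^⟨1⟩` it suffices to have involutions satisfying the
braid and the commutation relations. -/
theorem isLiftable_aInfOne {G : Type*} [Group G] {f : ℕ → G} (h1 : ∀ i, f i * f i = 1)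
    (h2 : ∀ i j, i + 1 < j → f i * f j = f j * f i)
    (h3 : ∀ i, f i * f (i + 1) * f i = f (i + 1) * f i * f (i + 1)) :
    coxeterMatrixAInfOne.IsLiftable f := by
  have two {i j : ℕ} (h : f i * f j = f j * f i) : (f i * f j) ^ 2 = 1 := by
    rw [pow_two]
    nth_rw 1 [h]
    rw [mul_assoc, ← mul_assoc (f i), h1, one_mul, h1]
  have three {i j : ℕ} (h : f i * f j * f i = f j * f i * f j) : (f i * f j) ^ 3 = 1 := by
    have : (f i * f j) ^ 3 = (f i * f j * f i) * (f j * f i * f j) := by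
      simp only [pow_succ, pow_zero, one_mul, mul_assoc]
    rw [this, ← h]
    have : f i * f j * f i * (f i * f j * f i) = f i * (f j * (f i * f i) * f j) * f i := by
      simp only [mul_assoc]
    rw [this, h1, mul_one, h1, mul_one, h1]
  intro i j
  rcases lt_trichotomy i j with h | rfl | h
  · rcases (Nat.succ_le_of_lt h).eq_or_lt with rfl | h'
    · rw [Nat.succ_eq_add_one, aInfOne_apply_eq_three]
      exact three (h3 i)
    · rw [aInfOne_apply_eq_two h']
      exact two (h2 _ _ h')
  · rw [CoxeterMatrix.diagonal, pow_one, h1]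
  · rcases (Nat.succ_le_of_lt h).eq_or_lt with rfl | h'
    · rw [Nat.succ_eq_add_one, aInfOne_apply_eq_three']
      exact three (h3 j).symm
    · rw [CoxeterMatrix.symmetric, aInfOne_apply_eq_two h']
      exact two (h2 _ _ h').symm

theorem isLiftable_swap : coxeterMatrixAInfOne.IsLiftable fun i : ℕ => swap i (i + 1) := by
  refine isLiftable_aInfOne (fun i => swap_mul_self _ _) (fun i j h => ?_) (fun i => ?_)
  · rw [mul_swap_eq_swap_mul, swap_apply_of_ne_of_ne (by omega) (by omega),
      swap_apply_of_ne_of_ne (by omega) (by omega)]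
  · rw [swap_mul_swap_mul_swap (by omega) (by omega), swap_comm i (i + 1),
      swap_comm (i + 1) (i + 2), swap_mul_swap_mul_swap (by omega) (by omega), swap_comm]

theorem isIrreducible_aInfOne : coxeterMatrixAInfOne.IsIrreducible := by
  have h (n : ℕ) : coxeterMatrixAInfOne.coxeterGraph.Reachable 0 n := by
    induction n with
    | zero => rfl
    | succ n ih =>
      refine ih.trans (SimpleGraph.Adj.reachable ⟨by omega, ?_⟩)
      rw [aInfOne_apply_eq_three]
      omega
  exact ⟨fun m n => (h m).symm.trans (h n)⟩

end CoxeterMatrix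

namespace AInfOne

section

variable {W : Type*} [Group W] (cs : CoxeterSystem coxeterMatrixAInfOne W)

/-! ### The permutation representation -/

/-- The action of `W` on `ℕ`, in which `s_k` acts as the transposition of `k` and `k + 1`. -/
noncomputable def perm : W →* Perm ℕ :=
  cs.lift ⟨fun i : ℕ => swap i (i + 1), CoxeterMatrix.isLiftable_swap⟩

@[simp] theorem perm_simple (i : ℕ) : perm cs (cs.simple i) = swap i (i + 1) :=
  cs.lift_apply_simple CoxeterMatrix.isLiftable_swap i

/-- The elements of `W` that fix all points outside `A`. -/
def supportedIn (A : Set ℕ) : Subgroup W where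
  carrier := {w | ∀ x ∉ A, perm cs w x = x}
  one_mem' := by simp
  mul_mem' {v w} hv hw x hx := by rw [map_mul, Perm.mul_apply, hw x hx, hv x hx]
  inv_mem' {w} hw x hx := by rw [map_inv, Perm.inv_eq_iff_eq, hw x hx]

theorem mem_supportedIn {A : Set ℕ} {w : W} :
    w ∈ supportedIn cs A ↔ ∀ x ∉ A, perm cs w x = x := Iff.rfl

theorem simple_mem_supportedIn {A : Set ℕ} {i : ℕ} (h : i ∈ A) (h' : i + 1 ∈ A) :
    cs.simple i ∈ supportedIn cs A := fun x hx => by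
  rw [perm_simple]
  exact swap_apply_of_ne_of_ne (fun e => hx (e ▸ h)) (fun e => hx (e ▸ h'))

/-! ### Normal form and faithfulness of the permutation representation. -/

theorem simple_mul_comm {i j : ℕ} (h : i + 1 < j) :
    cs.simple i * cs.simple j = cs.simple j * cs.simple i := by
  have := cs.simple_mul_simple_pow i j
  rw [CoxeterMatrix.aInfOne_apply_eq_two h, pow_two, mul_eq_one_iff_eq_inv] at this
  simpa using this

theorem simple_braid (i : ℕ) : cs.simple (i + 1) * cs.simple i * cs.simple (i + 1) =
    cs.simple i * cs.simple (i + 1) * cs.simple i := by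
  have := cs.simple_mul_simple_pow i (i + 1)
  have e : (cs.simple i * cs.simple (i + 1)) ^ 3 = (cs.simple i * cs.simple (i + 1) * cs.simple i) *
      (cs.simple (i + 1) * cs.simple i * cs.simple (i + 1)) := by
    simp only [pow_succ, pow_zero, one_mul, mul_assoc]
  rw [CoxeterMatrix.aInfOne_apply_eq_three, e, mul_eq_one_iff_inv_eq] at this
  simpa [mul_assoc] using this.symm

/-- The product `s_{k+d-1} ⋯ s_{k+1} s_k`. -/
def desc (k : ℕ) : ℕ → W
  | 0 => 1
  | d + 1 => cs.simple (k + d) * desc k d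

theorem desc_succ_right (k d : ℕ) : desc cs k (d + 1) = desc cs (k + 1) d * cs.simple k := by
  induction d with
  | zero => simp [desc]
  | succ d ih =>
    rw [desc, ih, ← mul_assoc, desc, show k + (d + 1) = k + 1 + d by omega]

theorem desc_comm_of_lt {j k : ℕ} (h : j + 1 < k) (d : ℕ) :
    desc cs k d * cs.simple j = cs.simple j * desc cs k d := by
  induction d with
  | zero => simp [desc]
  | succ d ih =>
    rw [desc, mul_assoc, ih, ← mul_assoc, ← mul_assoc,
      simple_mul_comm cs (show j + 1 < k + d by omega)]

theorem desc_comm_of_gt {j k d : ℕ} (h : k + d < j) :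
    desc cs k d * cs.simple j = cs.simple j * desc cs k d := by
  induction d with
  | zero => simp [desc]
  | succ d ih =>
    rw [desc, mul_assoc, ih (by omega), ← mul_assoc, ← mul_assoc, simple_mul_comm cs (by omega)]

/-- The braid relation lowers the index by one when `s_{j+1}` is the top factor of the product;
factors above it commute with the resulting `s_j`. -/
theorem desc_mul_simple {j k d : ℕ} (h : k ≤ j) (h' : j + 1 < k + d) :
    desc cs k d * cs.simple (j + 1) = cs.simple j * desc cs k d := by
  induction d with
  | zero => omega
  | succ d ih =>
    rcases lt_or_ge (j + 1) (k + d) with h1 | h1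
    · rw [desc, mul_assoc, ih h1, ← mul_assoc, ← mul_assoc, simple_mul_comm cs h1]
    · obtain ⟨e, rfl⟩ : ∃ e, d = e + 1 := ⟨d - 1, by omega⟩
      obtain rfl : j = k + e := by omega
      rw [desc, desc, mul_assoc, mul_assoc, desc_comm_of_gt cs (by omega), ← mul_assoc, ← mul_assoc,
        ← add_assoc, simple_braid]
      simp only [mul_assoc]

theorem perm_desc (k d : ℕ) : perm cs (desc cs k d) k = k + d := by
  induction d with
  | zero => simp [desc]
  | succ d ih => rw [desc, map_mul, Perm.mul_apply, ih, perm_simple, swap_apply_left, add_assoc]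

/-- Products of this form are stable under right multiplication by `s_j`, `j ≤ n`: for `j + 1 < k`
it passes through, for `j + 1 = k` it lengthens the descending word, for `j = k` it shortens it, and
for `j > k` it emerges on the left as `s_{j-1}`. -/
theorem exists_eq_mul_desc {n : ℕ} {w : W} (hw : w ∈ cs.standardParabolic (Set.Iio (n + 1))) :
    ∃ u ∈ cs.standardParabolic (Set.Iio n), ∃ k d, k + d = n + 1 ∧ w = u * desc cs k d := by
  have simple_mem {j : ℕ} (h : j < n) : cs.simple j ∈ cs.standardParabolic (Set.Iio n) :=
    Subgroup.subset_closure ⟨j, h, rfl⟩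
  have step {v : W} {j : ℕ} (hj : j < n + 1)
      (hv : ∃ u ∈ cs.standardParabolic (Set.Iio n), ∃ k d, k + d = n + 1 ∧ v = u * desc cs k d) :
      ∃ u ∈ cs.standardParabolic (Set.Iio n), ∃ k d, k + d = n + 1 ∧
        v * cs.simple j = u * desc cs k d := by
    obtain ⟨u, hu, k, d, hkd, rfl⟩ := hv
    rcases lt_trichotomy j k with h | rfl | h
    · rcases (Nat.succ_le_of_lt h).eq_or_lt with rfl | h'
      · exact ⟨u, hu, j, d + 1, by omega, by rw [mul_assoc, desc_succ_right]⟩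
      · exact ⟨u * cs.simple j, mul_mem hu (simple_mem (by omega)), k, d, hkd, by
          rw [mul_assoc, desc_comm_of_lt cs h', mul_assoc]⟩
    · obtain ⟨e, rfl⟩ : ∃ e, d = e + 1 := ⟨d - 1, by omega⟩
      exact ⟨u, hu, j + 1, e, by omega, by simp [desc_succ_right, mul_assoc]⟩
    · obtain ⟨i, rfl⟩ : ∃ i, j = i + 1 := ⟨j - 1, by omega⟩
      exact ⟨u * cs.simple i, mul_mem hu (simple_mem (by omega)), k, d, hkd, by
        rw [mul_assoc, desc_mul_simple cs (by omega) (by omega), mul_assoc]⟩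
  induction hw using Subgroup.closure_induction_right with
  | one => exact ⟨1, one_mem _, n + 1, 0, rfl, by simp [desc]⟩
  | mul_right v hv y hy ih =>
    obtain ⟨j, hj, rfl⟩ := hy
    exact step hj ih
  | mul_inv_cancel v hv y hy ih =>
    obtain ⟨j, hj, rfl⟩ := hy
    rw [cs.inv_simple]
    exact step hj ih

theorem exists_mem_standardParabolic_Iio (w : W) :
    ∃ n, w ∈ cs.standardParabolic (Set.Iio n) := by
  have mono {m n : ℕ} (h : m ≤ n) :
      cs.standardParabolic (Set.Iio m) ≤ cs.standardParabolic (Set.Iio n) :=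
    Subgroup.closure_mono (Set.image_mono (Set.Iio_subset_Iio h))
  induction w using cs.simple_induction_left with
  | one => exact ⟨0, one_mem _⟩
  | mul_simple_left w i ih =>
    obtain ⟨n, hn⟩ := ih
    exact ⟨max n (i + 1), mul_mem (Subgroup.subset_closure ⟨i, by simp, rfl⟩)
      (mono (le_max_left _ _) hn)⟩

theorem standardParabolic_Iio_le (n : ℕ) :
    cs.standardParabolic (Set.Iio n) ≤ supportedIn cs (Set.Iic n) := by
  rw [CoxeterSystem.standardParabolic, Subgroup.closure_le]
  rintro _ ⟨j, hj, rfl⟩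
  have : j < n := hj
  exact simple_mem_supportedIn cs (Set.mem_Iic.2 (by omega)) (Set.mem_Iic.2 (by omega))

/-- In the normal form `u * desc k d` the permutation sends `k` to `k + d = n + 1`, which `u` fixes.
If it is trivial then `d = 0`, and the element already lies in the smaller parabolic subgroup. -/
theorem perm_injective : Function.Injective (perm cs) := by
  rw [injective_iff_map_eq_one]
  intro w hw
  obtain ⟨n, hn⟩ := exists_mem_standardParabolic_Iio cs w
  induction n generalizing w with
  | zero => simpa [CoxeterSystem.standardParabolic] using hn
  | succ n ih =>
    obtain ⟨u, hu, k, d, hkd, rfl⟩ := exists_eq_mul_desc cs hn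
    have h1 := congrArg (fun σ => σ k) hw
    have h2 : perm cs u (n + 1) = n + 1 := standardParabolic_Iio_le cs n hu _ (by simp)
    simp only [map_mul, Perm.mul_apply, perm_desc, hkd, h2, Perm.one_apply] at h1
    obtain rfl : d = 0 := by omega
    rw [desc, mul_one] at hw ⊢
    exact ih u hw hu

theorem exists_perm_apply_eq_self (w : W) : ∃ N, ∀ x ≥ N, perm cs w x = x := by
  obtain ⟨n, hn⟩ := exists_mem_standardParabolic_Iio cs w
  exact ⟨n + 1, fun x hx => standardParabolic_Iio_le cs n hn x (by simp; omega)⟩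

theorem exists_perm_eq_swap (i j : ℕ) : ∃ w, perm cs w = swap i j := by
  have h (i d : ℕ) : ∃ w, perm cs w = swap i (i + d) := by
    induction d with
    | zero => exact ⟨1, by simp [Perm.one_def]⟩
    | succ d ih =>
      obtain ⟨w, hw⟩ := ih
      rcases Nat.eq_zero_or_pos d with rfl | hd
      · exact ⟨cs.simple i, perm_simple cs i⟩
      · refine ⟨cs.simple (i + d) * w * cs.simple (i + d), ?_⟩
        rw [map_mul, map_mul, hw, perm_simple, swap_comm (i + d), swap_comm (i + d + 1),
          swap_mul_swap_mul_swap (by omega) (by omega), swap_comm, add_assoc]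
  rcases le_total i j with hij | hij
  · obtain ⟨w, hw⟩ := h i (j - i)
    exact ⟨w, by rw [hw, Nat.add_sub_cancel' hij]⟩
  · obtain ⟨w, hw⟩ := h j (i - j)
    exact ⟨w, by rw [hw, Nat.add_sub_cancel' hij, swap_comm]⟩

/-! ### Roots -/

/-- The vectors `f_i` with `f_0 = 0` and `f_i - f_{i+1} = α_i`. -/
noncomputable def vec (i : ℕ) : coxeterMatrixAInfOne.GeomSpace :=
  -∑ k ∈ Finset.range i, coxeterMatrixAInfOne.simpleRoot k

theorem simpleRoot_eq (i : ℕ) : coxeterMatrixAInfOne.simpleRoot i = vec i - vec (i + 1) := by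
  rw [vec, vec, Finset.sum_range_succ]
  abel

theorem exampleRoot_eq (i : ℕ) : exampleRoot i = vec (2 * i) - vec (2 * (i + 1)) := by
  rw [exampleRoot, simpleRoot_eq, simpleRoot_eq, mul_add]
  abel

theorem vec_apply (i k : ℕ) : vec i k = if k < i then -1 else 0 := by
  simp only [vec, CoxeterMatrix.simpleRoot, Finsupp.neg_apply, Finsupp.finsetSum_apply,
    Finsupp.single_apply, Finset.sum_ite_eq', Finset.mem_range]
  split_ifs <;> simp

theorem vec_sub_apply_of_le {i j : ℕ} (h : i ≤ j) (k : ℕ) :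
    (vec i - vec j) k = if i ≤ k ∧ k < j then 1 else 0 := by
  rw [Finsupp.sub_apply, vec_apply, vec_apply]
  split_ifs <;> first | omega | norm_num

theorem vec_sub_nonneg_iff {i j : ℕ} : (∀ k, 0 ≤ (vec i - vec j) k) ↔ i ≤ j := by
  refine ⟨fun h => ?_, fun h k => ?_⟩
  · by_contra! hij
    have := h j
    rw [Finsupp.sub_apply, vec_apply, vec_apply, if_pos hij, if_neg (lt_irrefl j)] at this
    norm_num at this
  · rw [vec_sub_apply_of_le h]
    split_ifs <;> norm_num

/-- The coefficient vector is the indicator function of `[i, j)`, and a nonempty interval determines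
its endpoints. -/
theorem vec_sub_inj {i j i' j' : ℕ} (h : i < j) (e : vec i - vec j = vec i' - vec j') :
    i = i' ∧ j = j' := by
  have hne : i' ≤ j' := by
    rw [← vec_sub_nonneg_iff, ← e, vec_sub_nonneg_iff]
    exact h.le
  have key (k : ℕ) : (i ≤ k ∧ k < j) ↔ (i' ≤ k ∧ k < j') := by
    have := congrArg (fun v : coxeterMatrixAInfOne.GeomSpace => v k) e
    simp only [vec_sub_apply_of_le h.le, vec_sub_apply_of_le hne] at this
    split_ifs at this <;> first | tauto | norm_num at this
  have h1 := key i
  have h2 := key (j - 1)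
  have h3 := key i'
  have h4 := key (j' - 1)
  omega

theorem vec_sub_inj_of_ne {i j i' j' : ℕ} (h : i ≠ j) (e : vec i - vec j = vec i' - vec j') :
    i = i' ∧ j = j' := by
  rcases h.lt_or_gt with h | h
  · exact vec_sub_inj h e
  · have := vec_sub_inj h (i' := j') (j' := i') (by rw [← neg_sub, e, neg_sub])
    exact this.symm

theorem geomForm_simpleRoot_self (i : ℕ) : coxeterMatrixAInfOne.geomForm
    (coxeterMatrixAInfOne.simpleRoot i) (coxeterMatrixAInfOne.simpleRoot i) = 1 := by
  simp [CoxeterMatrix.geomForm_simpleRoot]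

theorem geomForm_simpleRoot_of_three {i j : ℕ} (h : coxeterMatrixAInfOne i j = 3) :
    coxeterMatrixAInfOne.geomForm
    (coxeterMatrixAInfOne.simpleRoot i) (coxeterMatrixAInfOne.simpleRoot j) = -(1 / 2) := by
  simp [CoxeterMatrix.geomForm_simpleRoot, h]

theorem geomForm_simpleRoot_of_two {i j : ℕ} (h : coxeterMatrixAInfOne i j = 2) :
    coxeterMatrixAInfOne.geomForm
    (coxeterMatrixAInfOne.simpleRoot i) (coxeterMatrixAInfOne.simpleRoot j) = 0 := by
  simp [CoxeterMatrix.geomForm_simpleRoot, h]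

theorem simpleReflection_vec_sub_succ (k i : ℕ) :
    coxeterMatrixAInfOne.simpleReflection k (vec i - vec (i + 1)) =
      vec (swap k (k + 1) i) - vec (swap k (k + 1) (i + 1)) := by
  rw [← simpleRoot_eq, CoxeterMatrix.simpleReflection_apply]
  obtain h | h | rfl | h | h : i + 1 < k ∨ i + 1 = k ∨ i = k ∨ i = k + 1 ∨ k + 1 < i := by omega
  · rw [geomForm_simpleRoot_of_two
      (by rw [CoxeterMatrix.symmetric, CoxeterMatrix.aInfOne_apply_eq_two h]),
      swap_apply_of_ne_of_ne (by omega) (by omega), swap_apply_of_ne_of_ne (by omega) (by omega),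
      simpleRoot_eq]
    simp
  · subst h
    rw [geomForm_simpleRoot_of_three (CoxeterMatrix.aInfOne_apply_eq_three' i),
      swap_apply_of_ne_of_ne (by omega) (by omega), swap_apply_left, simpleRoot_eq, simpleRoot_eq]
    module
  · rw [geomForm_simpleRoot_self, swap_apply_left, swap_apply_right, simpleRoot_eq]
    module
  · subst h
    rw [geomForm_simpleRoot_of_three (CoxeterMatrix.aInfOne_apply_eq_three k),
      swap_apply_right, swap_apply_of_ne_of_ne (by omega) (by omega), simpleRoot_eq, simpleRoot_eq]
    module
  · rw [geomForm_simpleRoot_of_two (CoxeterMatrix.aInfOne_apply_eq_two h),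
      swap_apply_of_ne_of_ne (by omega) (by omega), swap_apply_of_ne_of_ne (by omega) (by omega),
      simpleRoot_eq]
    simp

theorem simpleReflection_vec_sub (k i j : ℕ) :
    coxeterMatrixAInfOne.simpleReflection k (vec i - vec j) =
      vec (swap k (k + 1) i) - vec (swap k (k + 1) j) := by
  have h (i : ℕ) : coxeterMatrixAInfOne.simpleReflection k (vec 0 - vec i) =
      vec (swap k (k + 1) 0) - vec (swap k (k + 1) i) := by
    induction i with
    | zero => simp
    | succ i ih =>
      rw [← sub_add_sub_cancel (vec 0) (vec i), map_add, ih, simpleReflection_vec_sub_succ,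
        sub_add_sub_cancel]
  rw [← sub_sub_sub_cancel_left (vec j) (vec i) (vec 0), map_sub, h, h, sub_sub_sub_cancel_left]

/-- Only differences are permuted: the normalization `vec 0 = 0` is not preserved by `W`. -/
theorem geomRep_vec_sub (w : W) (i j : ℕ) :
    cs.geomRep w (vec i - vec j) = vec (perm cs w i) - vec (perm cs w j) := by
  induction w using cs.simple_induction_left generalizing i j with
  | one => simp
  | mul_simple_left w k ih =>
    rw [map_mul, LinearEquiv.mul_apply, ih, cs.geomRep_simple, simpleReflection_vec_sub, map_mul,
      perm_simple, Perm.mul_apply, Perm.mul_apply]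

theorem mem_roots {γ : coxeterMatrixAInfOne.GeomSpace} :
    γ ∈ cs.roots ↔ ∃ i j, i ≠ j ∧ γ = vec i - vec j := by
  constructor
  · rintro ⟨w, s, rfl⟩
    exact ⟨_, _, (perm cs w).injective.ne (Nat.succ_ne_self s).symm, by
      rw [simpleRoot_eq, geomRep_vec_sub]⟩
  · rintro ⟨i, j, hij, rfl⟩
    -- This transposition fixes `i` and moves `i + 1` to `j`, so it takes `α_i` to the given root.
    obtain ⟨w, hw⟩ := exists_perm_eq_swap cs (i + 1) j
    refine ⟨w, i, ?_⟩
    rw [simpleRoot_eq, geomRep_vec_sub, hw, swap_apply_left, swap_apply_of_ne_of_ne (by omega) hij]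

theorem mem_posRoots {γ : coxeterMatrixAInfOne.GeomSpace} :
    γ ∈ cs.posRoots ↔ ∃ i j, i < j ∧ γ = vec i - vec j := by
  constructor
  · rintro ⟨hr, hpos⟩
    obtain ⟨i, j, hij, rfl⟩ := (mem_roots cs).1 hr
    exact ⟨i, j, lt_of_le_of_ne (vec_sub_nonneg_iff.1 hpos) hij, rfl⟩
  · rintro ⟨i, j, hij, rfl⟩
    exact ⟨(mem_roots cs).2 ⟨i, j, hij.ne, rfl⟩, vec_sub_nonneg_iff.2 hij.le⟩

/-- Whatever `w` and `s` were chosen, the root determines the ordered pair `(w s, w (s + 1))`, hence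
the conjugated transposition. -/
theorem perm_rootReflection {i j : ℕ} (h : i ≠ j) :
    perm cs (cs.rootReflection (vec i - vec j)) = swap i j := by
  obtain ⟨w, s, hw, e⟩ := cs.rootReflection_spec ((mem_roots cs).2 ⟨i, j, h, rfl⟩)
  rw [simpleRoot_eq, geomRep_vec_sub] at hw
  obtain ⟨h1, h2⟩ := vec_sub_inj_of_ne h hw.symm
  rw [e, map_mul, map_mul, map_inv, perm_simple, ← swap_apply_apply, ← h1, ← h2]

theorem rootReflection_simpleRoot (i : ℕ) :
    cs.rootReflection (vec i - vec (i + 1)) = cs.simple i :=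
  perm_injective cs (by rw [perm_rootReflection cs (by omega), perm_simple])

theorem rootReflection_mem_supportedIn_iff {A : Set ℕ} {i j : ℕ} (h : i ≠ j) :
    cs.rootReflection (vec i - vec j) ∈ supportedIn cs A ↔ i ∈ A ∧ j ∈ A := by
  rw [mem_supportedIn, perm_rootReflection cs h]
  refine ⟨fun H => ⟨?_, ?_⟩, fun ⟨hi, hj⟩ x hx =>
    swap_apply_of_ne_of_ne (fun e => hx (e ▸ hi)) (fun e => hx (e ▸ hj))⟩
  · by_contra hi
    exact h (by simpa using (H i hi).symm)
  · by_contra hj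
    exact h (by simpa using H j hj)

/-- Infinitude provides, for each point of `A`, a second one to transpose it with; a singleton `A`
would give the trivial subgroup. -/
theorem supportedIn_le_iff {A B : Set ℕ} (hA : A.Infinite) :
    supportedIn cs A ≤ supportedIn cs B ↔ A ⊆ B := by
  refine ⟨fun H i hi => ?_, fun H w hw x hx => hw x fun h => hx (H h)⟩
  obtain ⟨j, hj, hij⟩ := hA.exists_gt i
  exact ((rootReflection_mem_supportedIn_iff cs hij.ne).1
    (H ((rootReflection_mem_supportedIn_iff cs hij.ne).2 ⟨hi, hj⟩))).1

theorem mem_posRoots_rootsOf_supportedIn {A : Set ℕ} {γ : coxeterMatrixAInfOne.GeomSpace} :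
    γ ∈ cs.rootsOf (supportedIn cs A) ∩ cs.posRoots ↔
      ∃ i ∈ A, ∃ j ∈ A, i < j ∧ γ = vec i - vec j := by
  constructor
  · rintro ⟨⟨_, hr⟩, hp⟩
    obtain ⟨i, j, hij, rfl⟩ := (mem_posRoots cs).1 hp
    obtain ⟨hi, hj⟩ := (rootReflection_mem_supportedIn_iff cs hij.ne).1 hr
    exact ⟨i, hi, j, hj, hij, rfl⟩
  · rintro ⟨i, hi, j, hj, hij, rfl⟩
    exact ⟨⟨(mem_roots cs).2 ⟨i, j, hij.ne, rfl⟩,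
      (rootReflection_mem_supportedIn_iff cs hij.ne).2 ⟨hi, hj⟩⟩,
      (mem_posRoots cs).2 ⟨i, j, hij, rfl⟩⟩

/-! ### The subgroup attached to a strictly increasing sequence -/

variable {g : ℕ → ℕ}

/-- The subgroup generated by the reflections that exchange consecutive terms of a sequence. -/
noncomputable def seqSubgroup (g : ℕ → ℕ) : Subgroup W :=
  Subgroup.closure (Set.range fun i => cs.rootReflection (vec (g i) - vec (g (i + 1))))

/-- By `mem_closure_isSwap`, a permutation lies in a group generated by transpositions iff it moves
finitely many points and keeps each point in its orbit. Consecutive transpositions make the range of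
`g` a single orbit. -/
theorem seqSubgroup_eq_supportedIn (hg : StrictMono g) :
    seqSubgroup cs g = supportedIn cs (Set.range g) := by
  have hne (i : ℕ) : g i ≠ g (i + 1) := (hg (Nat.lt_succ_self i)).ne
  apply le_antisymm
  · rw [seqSubgroup, Subgroup.closure_le]
    rintro _ ⟨i, rfl⟩
    exact (rootReflection_mem_supportedIn_iff cs (hne i)).2 ⟨⟨i, rfl⟩, ⟨i + 1, rfl⟩⟩
  · intro w hw
    rw [← Subgroup.mem_map_iff_mem (perm_injective cs), seqSubgroup, MonoidHom.map_closure,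
      mem_closure_isSwap]
    swap
    · rintro _ ⟨_, ⟨i, rfl⟩, rfl⟩
      exact ⟨_, _, hne i, perm_rootReflection cs (hne i)⟩
    set K := Subgroup.closure (perm cs ''
      Set.range fun i => cs.rootReflection (vec (g i) - vec (g (i + 1))))
    have horb (i : ℕ) : MulAction.orbit K (g i) = MulAction.orbit K (g 0) := by
      induction i with
      | zero => rfl
      | succ i ih =>
        rw [← ih, MulAction.orbit_eq_iff]
        refine ⟨⟨_, Subgroup.subset_closure ⟨_, ⟨i, rfl⟩, rfl⟩⟩, ?_⟩
        change perm cs _ (g i) = _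
        rw [perm_rootReflection cs (hne i), swap_apply_left]
    refine ⟨?_, fun x => ?_⟩
    · obtain ⟨N, hN⟩ := exists_perm_apply_eq_self cs w
      refine (Set.finite_lt_nat N).subset fun x hx => ?_
      by_contra hxN
      exact hx (hN x (not_lt.1 hxN))
    · by_cases hx : x ∈ Set.range g
      -- A value outside the range would be fixed by `w`, hence equal to `x` by injectivity.
      · have hwx : perm cs w x ∈ Set.range g := by
          by_contra h
          exact h (((perm cs w).injective (hw _ h)).symm ▸ hx)
        obtain ⟨i, rfl⟩ := hx
        obtain ⟨j, hj⟩ := hwx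
        rw [← hj, ← MulAction.orbit_eq_iff, horb j, horb i]
      · rw [hw x hx]
        exact MulAction.mem_orbit_self x

/-- A positive root joining nonconsecutive terms splits at an intermediate term. Conversely,
positive roots have nonnegative coefficients, so nothing cancels: each summand of a consecutive root
is supported in `[g i, g (i + 1))`, which leaves only that root. -/
theorem simpleRootsOf_seqSubgroup (hg : StrictMono g) :
    cs.simpleRootsOf (seqSubgroup cs g) = Set.range fun i => vec (g i) - vec (g (i + 1)) := by
  rw [seqSubgroup_eq_supportedIn cs hg]
  apply Set.Subset.antisymm
  · rintro γ ⟨hγ, H⟩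
    obtain ⟨_, ⟨i, rfl⟩, _, ⟨j, rfl⟩, hij, rfl⟩ := (mem_posRoots_rootsOf_supportedIn cs).1 hγ
    rcases (Nat.succ_le_of_lt (hg.lt_iff_lt.1 hij)).eq_or_lt with rfl | h
    · exact ⟨i, rfl⟩
    · have h1 : g i < g (i + 1) := hg (Nat.lt_succ_self i)
      have h2 : g (i + 1) < g j := hg h
      have := H 2 ![1, 1] ![vec (g i) - vec (g (i + 1)), vec (g (i + 1)) - vec (g j)]
        (by simp [Fin.forall_fin_two]) (by
          simp only [Fin.forall_fin_two, mem_posRoots_rootsOf_supportedIn]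
          exact ⟨⟨_, ⟨_, rfl⟩, _, ⟨_, rfl⟩, h1, rfl⟩, ⟨_, ⟨_, rfl⟩, _, ⟨_, rfl⟩, h2, rfl⟩⟩)
        (by simp) 0
      exact absurd (vec_sub_inj h1 this).2 h2.ne
  · rintro _ ⟨i, rfl⟩
    have h1 : g i < g (i + 1) := hg (Nat.lt_succ_self i)
    refine ⟨(mem_posRoots_rootsOf_supportedIn cs).2 ⟨_, ⟨_, rfl⟩, _, ⟨_, rfl⟩, h1, rfl⟩, ?_⟩
    intro k c b hc hb e m
    obtain ⟨_, ⟨p, rfl⟩, _, ⟨q, rfl⟩, hpq, hm⟩ := (mem_posRoots_rootsOf_supportedIn cs).1 (hb m)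
    have supp (x : ℕ) (hx : ¬(g i ≤ x ∧ x < g (i + 1))) : ¬(g p ≤ x ∧ x < g q) := by
      have h0 : ∑ l, c l * b l x = 0 := by
        have := congrArg (fun v : coxeterMatrixAInfOne.GeomSpace => v x) e
        simp only [vec_sub_apply_of_le h1.le, if_neg hx] at this
        simpa [Finsupp.finsetSum_apply] using this.symm
      rw [Finset.sum_eq_zero_iff_of_nonneg fun l _ => mul_nonneg (hc l).le ((hb l).2.2 x)] at h0
      intro hx'
      have := h0 m (Finset.mem_univ m)
      rw [hm, vec_sub_apply_of_le hpq.le, if_pos hx', mul_one] at this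
      exact (hc m).ne' this
    -- The first and last points of `[g p, g q)` suffice to locate it.
    have h2 := supp (g p)
    have h3 := supp (g q - 1)
    have h4 : g i ≤ g p := by omega
    have h5 : g q ≤ g (i + 1) := by omega
    rw [hg.le_iff_le] at h4 h5
    rw [hg.lt_iff_lt] at hpq
    obtain rfl : p = i := by omega
    obtain rfl : q = p + 1 := by omega
    exact hm

theorem canonicalGenerators_seqSubgroup (hg : StrictMono g) :
    cs.canonicalGenerators (seqSubgroup cs g) =
      Set.range fun i => cs.rootReflection (vec (g i) - vec (g (i + 1))) := by
  rw [CoxeterSystem.canonicalGenerators, simpleRootsOf_seqSubgroup cs hg, ← Set.range_comp]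
  rfl

/-- Relabelling points along `g` embeds `Perm ℕ` in itself and takes `(i i+1)` to `(g i g(i+1))`.
The relations thus transfer, and the induced endomorphism of `W` is injective with the required
image. -/
theorem exists_coxeterSystem_seqSubgroup (hg : StrictMono g) :
    ∃ csg : CoxeterSystem coxeterMatrixAInfOne (seqSubgroup cs g),
      ∀ i, (csg.simple i : W) = cs.rootReflection (vec (g i) - vec (g (i + 1))) := by
  let ι : ℕ ↪ ℕ := ⟨g, hg.injective⟩
  have hι (i : ℕ) : Perm.viaEmbeddingHom ι (swap i (i + 1)) =
      perm cs (cs.rootReflection (vec (g i) - vec (g (i + 1)))) := by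
    rw [perm_rootReflection cs (hg (Nat.lt_succ_self i)).ne, Perm.viaEmbeddingHom_apply]
    ext x
    by_cases hx : x ∈ Set.range ι
    · obtain ⟨y, rfl⟩ := hx
      rw [Perm.viaEmbedding_apply]
      exact (hg.injective.swap_apply i (i + 1) y).symm
    · rw [Perm.viaEmbedding_apply_of_notMem _ _ x hx, swap_apply_of_ne_of_ne]
      · exact fun h => hx ⟨i, h.symm⟩
      · exact fun h => hx ⟨i + 1, h.symm⟩
  have hlift : coxeterMatrixAInfOne.IsLiftable
      fun i => cs.rootReflection (vec (g i) - vec (g (i + 1))) := fun i j => by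
    apply perm_injective cs
    rw [map_pow, map_mul, ← hι, ← hι, ← map_mul, ← map_pow, CoxeterMatrix.isLiftable_swap, map_one,
      map_one]
  set ψ : W →* W := cs.lift ⟨_, hlift⟩
  have hψs (i : ℕ) : ψ (cs.simple i) = cs.rootReflection (vec (g i) - vec (g (i + 1))) :=
    cs.lift_apply_simple hlift i
  have hcomp : (perm cs).comp ψ = (Perm.viaEmbeddingHom ι).comp (perm cs) := by
    apply cs.ext_simple
    intro i
    rw [MonoidHom.comp_apply, MonoidHom.comp_apply, hψs, perm_simple, hι]
  have hψ : Function.Injective ψ := by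
    apply Function.Injective.of_comp (f := perm cs)
    rw [← MonoidHom.coe_comp, hcomp, MonoidHom.coe_comp]
    exact (Perm.viaEmbeddingHom_injective ι).comp (perm_injective cs)
  have hrange : ψ.range = seqSubgroup cs g := by
    rw [MonoidHom.range_eq_map, ← cs.subgroup_closure_range_simple, MonoidHom.map_closure,
      ← Set.range_comp, seqSubgroup]
    congr 2
    exact funext hψs
  exact ⟨cs.map ((MonoidHom.ofInjective hψ).trans (MulEquiv.subgroupCongr hrange)), hψs⟩

theorem map_conj_supportedIn (w : W) (A B : Set ℕ) (h : ∀ x, perm cs w x ∈ A ↔ x ∈ B) :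
    (supportedIn cs B).map (MulAut.conj w).toMonoidHom = supportedIn cs A := by
  ext v
  rw [Subgroup.mem_map_equiv, MulAut.conj_symm_apply, mem_supportedIn, mem_supportedIn]
  constructor
  · intro H x hx
    have := H ((perm cs w)⁻¹ x) (by simpa [← h] using hx)
    simpa using this
  · intro H x hx
    have := H (perm cs w x) (by rwa [h])
    simp [this]

theorem supportedIn_Ici (n : ℕ) : supportedIn cs (Set.Ici n) = cs.standardParabolic (Set.Ici n) := by
  have hg : StrictMono fun i => i + n := fun i j h => Nat.add_lt_add_right h n
  have hr : Set.range (fun i => i + n) = Set.Ici n := by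
    ext x
    exact ⟨by rintro ⟨i, rfl⟩; simp, fun h => ⟨x - n, Nat.sub_add_cancel h⟩⟩
  rw [← hr, ← seqSubgroup_eq_supportedIn cs hg, seqSubgroup, CoxeterSystem.standardParabolic,
    ← Set.range_comp]
  congr 2
  ext1 i
  rw [Function.comp_apply, ← rootReflection_simpleRoot, show i + 1 + n = i + n + 1 by omega]

/-! ### The chain -/

/-- The increasing enumeration of the numbers that are even or at least `2 * n`. -/
def chainSeq (n k : ℕ) : ℕ := if k < n then 2 * k else k + n

theorem strictMono_chainSeq (n : ℕ) : StrictMono (chainSeq n) := by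
  intro i j h
  unfold chainSeq
  split_ifs <;> omega

theorem range_chainSeq (n : ℕ) : Set.range (chainSeq n) = {x | Even x ∨ 2 * n ≤ x} := by
  ext x
  constructor
  · rintro ⟨k, rfl⟩
    unfold chainSeq
    split_ifs
    · exact Or.inl (even_two_mul k)
    · exact Or.inr (by omega)
  · intro h
    rcases le_or_gt (2 * n) x with hx | hx
    · exact ⟨x - n, by unfold chainSeq; split_ifs <;> omega⟩
    · obtain ⟨k, rfl⟩ := (h.resolve_right (by omega)).two_dvd
      exact ⟨k, by unfold chainSeq; split_ifs <;> omega⟩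

theorem vec_chainSeq_sub (n k : ℕ) : vec (chainSeq n k) - vec (chainSeq n (k + 1)) =
    if k < n then exampleRoot k else coxeterMatrixAInfOne.simpleRoot (k + n) := by
  split_ifs with h
  · rw [exampleRoot_eq, chainSeq, chainSeq, if_pos h]
    congr 2
    -- At the junction `k + 1 = n`, the second branch gives `n + n`, which agrees with `2 * (k +
    -- 1)`.
    split_ifs <;> omega
  · rw [simpleRoot_eq, chainSeq, chainSeq, if_neg h, if_neg (by omega), add_right_comm]

theorem rootReflection_chainSeq (n k : ℕ) :
    cs.rootReflection (vec (chainSeq n k) - vec (chainSeq n (k + 1))) =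
      if k < n then cs.rootReflection (exampleRoot k) else cs.simple (k + n) := by
  rw [vec_chainSeq_sub]
  split_ifs
  · rfl
  · rw [simpleRoot_eq, rootReflection_simpleRoot]

theorem range_ite_lt {α : Type*} (a b : ℕ → α) (n : ℕ) :
    (Set.range fun k => if k < n then a k else b (k + n)) =
      a '' {i | i < n} ∪ b '' {k | 2 * n ≤ k} := by
  ext x
  constructor
  · rintro ⟨k, rfl⟩
    dsimp only
    split_ifs with h
    · exact Or.inl ⟨k, h, rfl⟩
    · exact Or.inr ⟨k + n, by simp; omega, rfl⟩
  · rintro (⟨k, hk, rfl⟩ | ⟨k, hk, rfl⟩)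
    · exact ⟨k, if_pos hk⟩
    · have hk' : 2 * n ≤ k := hk
      refine ⟨k - n, ?_⟩
      dsimp only
      rw [if_neg (by omega), Nat.sub_add_cancel (by omega)]

theorem exampleChain_eq_seqSubgroup (n : ℕ) : exampleChain cs n = seqSubgroup cs (chainSeq n) := by
  simp only [exampleChain, seqSubgroup, rootReflection_chainSeq, range_ite_lt]

theorem exampleChain_eq_supportedIn (n : ℕ) :
    exampleChain cs n = supportedIn cs {x | Even x ∨ 2 * n ≤ x} := by
  rw [exampleChain_eq_seqSubgroup, seqSubgroup_eq_supportedIn cs (strictMono_chainSeq n),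
    range_chainSeq]

theorem strictMono_two_mul : StrictMono fun i : ℕ => 2 * i := fun i j h => by
  dsimp only
  omega

theorem exampleSubgroup_eq_seqSubgroup : exampleSubgroup cs = seqSubgroup cs fun i => 2 * i := by
  simp only [exampleSubgroup, seqSubgroup, exampleRoot_eq]

theorem exampleSubgroup_eq_supportedIn : exampleSubgroup cs = supportedIn cs {x | Even x} := by
  rw [exampleSubgroup_eq_seqSubgroup, seqSubgroup_eq_supportedIn cs strictMono_two_mul,
    range_two_mul ℕ]

/-! ### Intersection, parabolicity and strictness of the chain. -/

theorem iInf_exampleChain : ⨅ n, exampleChain cs n = exampleSubgroup cs := by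
  apply le_antisymm
  · rw [exampleSubgroup_eq_supportedIn]
    intro w hw x hx
    rw [Subgroup.mem_iInf] at hw
    -- An odd `x` is below `2 * (x + 1)`, so this term of the chain already fixes it.
    have := hw (x + 1)
    rw [exampleChain_eq_supportedIn] at this
    exact this x fun h => h.elim hx (by omega)
  · refine le_iInf fun n => ?_
    rw [exampleChain_eq_supportedIn, exampleSubgroup_eq_supportedIn]
    exact fun w hw x hx => hw x fun h => hx (Or.inl h)

/-- Some element of `W` carries `0, …, n - 1` to the first `n` odd numbers. -/
theorem exists_perm_apply_eq_odd (n : ℕ) : ∃ w, ∀ i < n, perm cs w i = 2 * i + 1 := by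
  induction n with
  | zero => exact ⟨1, by simp⟩
  | succ n ih =>
    obtain ⟨w, hw⟩ := ih
    -- Correct the image of `n` afterwards; the values already arranged avoid both transposed
    -- points.
    obtain ⟨t, ht⟩ := exists_perm_eq_swap cs (perm cs w n) (2 * n + 1)
    refine ⟨t * w, fun i hi => ?_⟩
    rw [map_mul, Perm.mul_apply, ht]
    rcases (Nat.lt_succ_iff.1 hi).eq_or_lt with rfl | h
    · exact swap_apply_left _ _
    · rw [swap_apply_of_ne_of_ne ((perm cs w).injective.ne h.ne) (by rw [hw i h]; omega), hw i h]

theorem isParabolic_exampleChain (n : ℕ) : cs.IsParabolic (exampleChain cs n) := by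
  obtain ⟨w, hw⟩ := exists_perm_apply_eq_odd cs n
  refine ⟨w, Set.Ici n, ?_⟩
  rw [← supportedIn_Ici, exampleChain_eq_supportedIn]
  refine (map_conj_supportedIn cs w _ _ fun x => ?_).symm
  rw [Set.mem_Ici]
  constructor
  · intro h
    by_contra! hx
    have h' : Even (perm cs w x) ∨ 2 * n ≤ perm cs w x := h
    rw [hw x hx, Nat.even_iff] at h'
    omega
  · intro hx
    by_contra h
    have h' : ¬(Even (perm cs w x) ∨ 2 * n ≤ perm cs w x) := h
    rw [Nat.even_iff] at h'
    -- An odd value below `2 * n` is already taken at its half, an index below `n`.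
    have e : perm cs w (perm cs w x / 2) = perm cs w x := by
      rw [hw _ (by omega)]
      omega
    have := (perm cs w).injective e
    omega

theorem parabolicClosure_exampleSubgroup :
    cs.parabolicClosure (exampleSubgroup cs : Set W) = exampleSubgroup cs := by
  apply le_antisymm
  · conv_rhs => rw [← iInf_exampleChain cs]
    exact le_iInf fun n => sInf_le ⟨isParabolic_exampleChain cs n,
      (iInf_exampleChain cs).ge.trans (iInf_le _ n)⟩
  · exact le_sInf fun P hP => hP.2

/-- Let `w` fix everything from `N` on. For `i ≥ N`, conjugation leaves `s_i` unchanged, and `s_i`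
moves an odd number, so `I` lies below `N`. Then the conjugate of `W_I` fixes every number above
`N`, whereas `G` moves arbitrarily large even numbers. -/
theorem not_isParabolic_exampleSubgroup : ¬cs.IsParabolic (exampleSubgroup cs) := by
  rintro ⟨w, I, h⟩
  rw [exampleSubgroup_eq_supportedIn] at h
  obtain ⟨N, hN⟩ := exists_perm_apply_eq_self cs w
  have hI {i : ℕ} (hi : i ∈ I) : i < N := by
    by_contra! hiN
    have hmem : w * cs.simple i * w⁻¹ ∈ supportedIn cs {x | Even x} := by
      rw [h]
      exact ⟨cs.simple i, Subgroup.subset_closure ⟨i, hi, rfl⟩, rfl⟩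
    have hp : perm cs (w * cs.simple i * w⁻¹) = swap i (i + 1) := by
      rw [map_mul, map_mul, map_inv, perm_simple, ← swap_apply_apply, hN i hiN, hN _ (by omega)]
    rw [mem_supportedIn, hp] at hmem
    rcases Nat.even_or_odd i with he | ho
    · have := hmem (i + 1) (by simpa [Nat.even_add_one] using he)
      simp at this
    · have := hmem i (Nat.not_even_iff_odd.2 ho)
      simp at this
  have hfix : supportedIn cs {x | Even x} ≤ supportedIn cs (Set.Iic N) := by
    rw [h, Subgroup.map_le_iff_le_comap, CoxeterSystem.standardParabolic, Subgroup.closure_le]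
    rintro _ ⟨i, hi, rfl⟩ x hx
    have hx' : N < x := by simpa using hx
    have := hI hi
    have hw : (perm cs w)⁻¹ x = x := by rw [Perm.inv_eq_iff_eq, hN x hx'.le]
    have hs : swap i (i + 1) x = x := swap_apply_of_ne_of_ne (by omega) (by omega)
    change perm cs (w * cs.simple i * w⁻¹) x = x
    rw [map_mul, map_mul, map_inv, perm_simple, Perm.mul_apply, Perm.mul_apply, hw, hs, hN x hx'.le]
  have hinf : {x : ℕ | Even x}.Infinite := by
    rw [← range_two_mul ℕ]
    exact Set.infinite_range_of_injective strictMono_two_mul.injective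
  exact hinf ((Set.finite_Iic N).subset ((supportedIn_le_iff cs hinf).1 hfix))

theorem exampleChain_zero : exampleChain cs 0 = ⊤ := by
  rw [exampleChain_eq_supportedIn, eq_top_iff]
  intro w _ x hx
  exact absurd (Or.inr (Nat.zero_le x)) hx

theorem exampleChain_succ_lt (n : ℕ) : exampleChain cs (n + 1) < exampleChain cs n := by
  have hinf (n : ℕ) : {x : ℕ | Even x ∨ 2 * n ≤ x}.Infinite := by
    rw [← range_chainSeq]
    exact Set.infinite_range_of_injective (strictMono_chainSeq n).injective
  rw [lt_iff_le_not_ge, exampleChain_eq_supportedIn, exampleChain_eq_supportedIn,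
    supportedIn_le_iff cs (hinf _), supportedIn_le_iff cs (hinf _)]
  refine ⟨fun x hx => hx.imp_right fun h => by omega, fun h => ?_⟩
  -- The odd number `2 * n + 1` is lost in passing to the next term.
  have : Even (2 * n + 1) ∨ 2 * (n + 1) ≤ 2 * n + 1 := h (Or.inr (by omega))
  rw [Nat.even_iff] at this
  omega

theorem exampleRoot_mem_posRoots (i : ℕ) : exampleRoot i ∈ cs.posRoots :=
  (mem_posRoots cs).2 ⟨2 * i, 2 * (i + 1), by omega, exampleRoot_eq i⟩

theorem isReflectionSubgroup_exampleSubgroup : cs.IsReflectionSubgroup (exampleSubgroup cs) := by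
  refine ⟨_, ?_, rfl⟩
  rintro _ ⟨i, rfl⟩
  obtain ⟨w, s, _, h⟩ := cs.rootReflection_spec (exampleRoot_mem_posRoots cs i).1
  exact ⟨w, s, h⟩

end

end AInfOne

theorem mainTheorem4 {W : Type*} [Group W] (cs : CoxeterSystem coxeterMatrixAInfOne W) :
    -- the `β_i` are positive roots, and `G` is a reflection subgroup
    (∀ i : ℕ, exampleRoot i ∈ cs.posRoots) ∧
    cs.IsReflectionSubgroup (exampleSubgroup cs) ∧
    -- `Π(G) = {β_i}`, and `S(G) = X = {s_{β_i}}`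
    cs.simpleRootsOf (exampleSubgroup cs) = Set.range exampleRoot ∧
    cs.canonicalGenerators (exampleSubgroup cs) =
      Set.range (fun i : ℕ => cs.rootReflection (exampleRoot i)) ∧
    -- `(G, S(G))` is a Coxeter system of type `A_∞^⟨1⟩`, which is irreducible
    (∃ csG : CoxeterSystem coxeterMatrixAInfOne (exampleSubgroup cs),
      ∀ i : ℕ, (csG.simple i : W) = cs.rootReflection (exampleRoot i)) ∧
    coxeterMatrixAInfOne.IsIrreducible ∧
    -- `G` is its own parabolic closure, but is not parabolic
    cs.parabolicClosure (exampleSubgroup cs : Set W) = exampleSubgroup cs ∧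
    ¬ cs.IsParabolic (exampleSubgroup cs) ∧
    -- `G_0 > G_1 > G_2 > ⋯` are parabolic subgroups with intersection `G`; their canonical
    -- generators are the defining ones, and form a Coxeter system of type `A_∞^⟨1⟩`
    (∀ n : ℕ, cs.IsParabolic (exampleChain cs n)) ∧
    (∀ n : ℕ, cs.simpleRootsOf (exampleChain cs n) =
      exampleRoot '' {i | i < n} ∪ coxeterMatrixAInfOne.simpleRoot '' {k | 2 * n ≤ k}) ∧
    (∀ n : ℕ, cs.canonicalGenerators (exampleChain cs n) =
      (fun i : ℕ => cs.rootReflection (exampleRoot i)) '' {i | i < n} ∪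
        cs.simple '' {k | 2 * n ≤ k}) ∧
    (∀ n : ℕ, ∃ csn : CoxeterSystem coxeterMatrixAInfOne (exampleChain cs n),
      ∀ k : ℕ, (csn.simple k : W) =
        if k < n then cs.rootReflection (exampleRoot k) else cs.simple (k + n)) ∧
    exampleChain cs 0 = ⊤ ∧
    (∀ n : ℕ, exampleChain cs (n + 1) < exampleChain cs n) ∧
    ⨅ n : ℕ, exampleChain cs n = exampleSubgroup cs := by
  refine ⟨AInfOne.exampleRoot_mem_posRoots cs, AInfOne.isReflectionSubgroup_exampleSubgroup cs,
    ?_, ?_, ?_, CoxeterMatrix.isIrreducible_aInfOne, AInfOne.parabolicClosure_exampleSubgroup cs,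
    AInfOne.not_isParabolic_exampleSubgroup cs, AInfOne.isParabolic_exampleChain cs,
    fun n => ?_, fun n => ?_, fun n => ?_, AInfOne.exampleChain_zero cs,
    AInfOne.exampleChain_succ_lt cs, AInfOne.iInf_exampleChain cs⟩
  · rw [AInfOne.exampleSubgroup_eq_seqSubgroup,
      AInfOne.simpleRootsOf_seqSubgroup cs AInfOne.strictMono_two_mul]
    simp only [← AInfOne.exampleRoot_eq]
  · rw [AInfOne.exampleSubgroup_eq_seqSubgroup,
      AInfOne.canonicalGenerators_seqSubgroup cs AInfOne.strictMono_two_mul]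
    simp only [← AInfOne.exampleRoot_eq]
  · rw [AInfOne.exampleSubgroup_eq_seqSubgroup]
    simp only [AInfOne.exampleRoot_eq]
    exact AInfOne.exists_coxeterSystem_seqSubgroup cs AInfOne.strictMono_two_mul
  · rw [AInfOne.exampleChain_eq_seqSubgroup,
      AInfOne.simpleRootsOf_seqSubgroup cs (AInfOne.strictMono_chainSeq n)]
    simp only [AInfOne.vec_chainSeq_sub, AInfOne.range_ite_lt]
  · rw [AInfOne.exampleChain_eq_seqSubgroup,
      AInfOne.canonicalGenerators_seqSubgroup cs (AInfOne.strictMono_chainSeq n)]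
    simp only [AInfOne.rootReflection_chainSeq, AInfOne.range_ite_lt]
  · rw [AInfOne.exampleChain_eq_seqSubgroup]
    simp only [← AInfOne.rootReflection_chainSeq]
    exact AInfOne.exists_coxeterSystem_seqSubgroup cs (AInfOne.strictMono_chainSeq n)
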